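/- For a subset $K$ of a Banach space $X$ and an integer $n\ge 0$, let $\varepsilon_n(K)_X$ denote the $n$-th entropy number of $K$, i.e. the infimum of all $\varepsilon>0$ for which $K$ can be covered by $2^n$ balls of $X$ of radius $\varepsilon$; write $\ell_\infty^{m}=(\mathbb{R}^{m},\|\cdot\|_{\ell_\infty})$. There is an absolute constant $C>0$ such that the following holds. Let $X$ be a (real) Banach space and let $K\subset X$ be compact. Then for every integer $n\ge 1$ there are Lipschitz mappings $$a_n:X\to \ell_\infty^{26n},\qquad M_n:\ell_\infty^{26n}\to X,$$ each with Lipschitz constant at most $Cn^{5/4}$, such that $$\sup_{f\in K}\|f-M_n(a_n(f))\|_X\le C\,n^{5/2}\,\varepsilon_n(K)_X .$$ -/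

import Mathlib

open scoped NNReal

universe u

/-- The entropy number `ε_n(K)_X`: the infimum of all `ε > 0` for which `2 ^ n` balls of radius `ε`
(with centres anywhere in `X`, repetitions allowed) cover `K`. For compact `K` the set of such `ε`
is nonempty and bounded below by `0`. -/
noncomputable def entropyNumber {X : Type u} [PseudoMetricSpace X] (n : ℕ) (K : Set X) : ℝ :=
  sInf {ε : ℝ | 0 < ε ∧ ∃ c : Fin (2 ^ n) → X, K ⊆ ⋃ i, Metric.closedBall (c i) ε}

/-! Replace `K` by a net `A` of at most `2 ^ n` points. Bourgain's random distance functions,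
superposed with random signs, give for each set of pairs in `A` one real-valued Lipschitz function
which separates a fixed proportion of these pairs; choosing coordinates greedily, `26 n` of them
separate all pairs. The resulting map into `ℓ_∞^{26n}` has Lipschitz constant `2 n`, and its inverse
on `A` has Lipschitz constant of order `n ^ (1/2)`. This inverse extends to the whole space by
averaging over the balls that just reach the image of `A`, at the cost of a factor linear in the
dimension. Scaling by `n ^ (1/4)` balances the two constants `n` and `n ^ (3/2)`, and the error on
`K` is at most the product of the two Lipschitz constants times the distance to the net. -/

open scoped Finset

section Averaging

theorem exists_mul_sum_le_sum_filter {Ω κ : Type*} {T : Finset Ω} {P : Finset κ} {μ : Ω → ℝ}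
    {w : κ → ℝ} (E : Ω → κ → Prop) [∀ ω k, Decidable (E ω k)] {p : ℝ} (hμ : ∀ ω ∈ T, 0 ≤ μ ω)
    (hμ_sum : ∑ ω ∈ T, μ ω = 1) (hw : ∀ k ∈ P, 0 ≤ w k)
    (hE : ∀ k ∈ P, 0 < w k → p ≤ ∑ ω ∈ T with E ω k, μ ω) :
    ∃ ω ∈ T, p * ∑ k ∈ P, w k ≤ ∑ k ∈ P with E ω k, w k := by
  obtain ⟨ω, hω, h⟩ := (convexOn_id convex_univ).exists_ge_of_centerMass
    (p := fun ω => ∑ k ∈ P with E ω k, w k) hμ (hμ_sum ▸ one_pos) fun _ _ => Set.mem_univ _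
  refine ⟨ω, hω, le_trans ?_ h⟩
  calc p * ∑ k ∈ P, w k = ∑ k ∈ P, p * w k := Finset.mul_sum ..
    _ ≤ ∑ k ∈ P, (∑ ω ∈ T with E ω k, μ ω) * w k := Finset.sum_le_sum fun k hk => by
      rcases (hw k hk).eq_or_lt with hk₀ | hk₀
      · simp [← hk₀]
      · exact mul_le_mul_of_nonneg_right (hE k hk hk₀) hk₀.le
    _ = ∑ k ∈ P, ∑ ω ∈ T, if E ω k then μ ω * w k else 0 := by
      simp only [Finset.sum_mul, Finset.sum_filter, ite_mul, zero_mul]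
    _ = ∑ ω ∈ T, μ ω * ∑ k ∈ P with E ω k, w k := by
      rw [Finset.sum_comm]
      simp only [Finset.mul_sum, Finset.sum_filter, mul_ite, mul_zero]
    _ = id (T.centerMass μ fun ω => ∑ k ∈ P with E ω k, w k) := by
      simp only [T.centerMass_eq_of_sum_1 _ hμ_sum, smul_eq_mul, id_eq]

variable {ι : Type*} {s : Finset ι} {u : ι → ℝ} {θ : ℝ}

theorem sum_le_card_mul_add_sum_filter (hθ : 0 ≤ θ) :
    ∑ i ∈ s, u i ≤ #s * θ + ∑ i ∈ s with θ ≤ u i, u i := by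
  rw [← Finset.sum_filter_not_add_sum_filter s (θ ≤ u ·)]
  gcongr
  calc ∑ i ∈ s with ¬θ ≤ u i, u i ≤ #{i ∈ s | ¬θ ≤ u i} • θ :=
        Finset.sum_le_card_nsmul _ _ _ fun i hi => (not_le.1 (Finset.mem_filter.1 hi).2).le
    _ ≤ #s * θ := by
      rw [nsmul_eq_mul]
      gcongr
      exact Finset.filter_subset _ _

theorem sum_le_card_mul_add_card_filter (hθ : 0 ≤ θ) (hu : ∀ i ∈ s, u i ≤ 1) :
    ∑ i ∈ s, u i ≤ #s * θ + #{i ∈ s | θ ≤ u i} := by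
  refine (sum_le_card_mul_add_sum_filter hθ).trans ?_
  gcongr
  calc ∑ i ∈ s with θ ≤ u i, u i ≤ #{i ∈ s | θ ≤ u i} • (1 : ℝ) :=
        Finset.sum_le_card_nsmul _ _ _ fun i hi => hu i (Finset.mem_filter.1 hi).1
    _ = #{i ∈ s | θ ≤ u i} := by simp

theorem sq_sum_sub_card_mul_le_card_filter_mul_sum_sq (hθ : 0 ≤ θ) (h : #s * θ ≤ ∑ i ∈ s, u i) :
    (∑ i ∈ s, u i - #s * θ) ^ 2 ≤ #{i ∈ s | θ ≤ u i} * ∑ i ∈ s, u i ^ 2 :=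
  calc (∑ i ∈ s, u i - #s * θ) ^ 2 ≤ (∑ i ∈ s with θ ≤ u i, u i) ^ 2 :=
        pow_le_pow_left₀ (sub_nonneg.2 h)
          (by linarith [sum_le_card_mul_add_sum_filter (s := s) (u := u) hθ]) 2
    _ ≤ #{i ∈ s | θ ≤ u i} * ∑ i ∈ s with θ ≤ u i, u i ^ 2 := sq_sum_le_card_mul_sum_sq
    _ ≤ #{i ∈ s | θ ≤ u i} * ∑ i ∈ s, u i ^ 2 := by
      gcongr
      exact Finset.filter_subset _ _

open Classical in
theorem exists_greedy_cover {κ Φ : Type*} (sat : Φ → κ → Prop) {P : Finset κ} {q : ℝ} (hq : 0 ≤ q)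
    (h : ∀ Q ⊆ P, ∃ φ, (1 - q) * #Q ≤ #{k ∈ Q | sat φ k}) {m : ℕ} (hm : q ^ m * #P < 1) :
    ∃ φ : Fin m → Φ, ∀ k ∈ P, ∃ i, sat (φ i) k := by
  induction m generalizing P with
  | zero =>
    have hP : P = ∅ := by simpa using hm
    exact ⟨Fin.elim0, by simp [hP]⟩
  | succ m ih =>
    obtain ⟨ψ, hψ⟩ := h P subset_rfl
    have hrest : (#{k ∈ P | ¬sat ψ k} : ℝ) ≤ q * #P := by
      have := Finset.card_filter_add_card_filter_not (s := P) (sat ψ)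
      have : (#{k ∈ P | sat ψ k} + #{k ∈ P | ¬sat ψ k} : ℝ) = #P := mod_cast this
      linarith
    obtain ⟨φ, hφ⟩ := ih (P := {k ∈ P | ¬sat ψ k})
      (fun Q hQ => h Q (hQ.trans (Finset.filter_subset _ _))) <| by
        calc q ^ m * #{k ∈ P | ¬sat ψ k} ≤ q ^ m * (q * #P) := by gcongr
          _ = q ^ (m + 1) * #P := by ring
          _ < 1 := hm
    refine ⟨Fin.cons ψ φ, fun k hk => ?_⟩
    by_cases hkψ : sat ψ k
    · exact ⟨0, hkψ⟩
    · obtain ⟨i, hi⟩ := hφ k (Finset.mem_filter.2 ⟨hk, hkψ⟩)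
      exact ⟨i.succ, by simpa using hi⟩

end Averaging

section RandomSubset

variable {α κ ι : Type*} [DecidableEq α] {A G H : Finset α}

theorem sum_powerset_disjoint_weight {R : Type*} [CommRing R] (hG : G ⊆ A) (s : R) :
    ∑ S ∈ A.powerset with Disjoint S G, (1 - s) ^ #S * s ^ (#A - #S) = s ^ #G := by
  have hfilter : {S ∈ A.powerset | Disjoint S G} = (A \ G).powerset := by
    ext S
    simp [Finset.subset_sdiff]
  have hcard : #(A \ G) + #G = #A := Finset.card_sdiff_add_card_eq_card hG
  calc _ = ∑ S ∈ (A \ G).powerset, ((1 - s) ^ #S * s ^ (#(A \ G) - #S)) * s ^ #G := by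
        rw [hfilter]
        refine Finset.sum_congr rfl fun S hS => ?_
        have hS' := Finset.card_le_card (Finset.mem_powerset.1 hS)
        rw [mul_assoc, ← pow_add]
        congr 2
        omega
    _ = s ^ #G := by
      rw [← Finset.sum_mul, Finset.sum_pow_mul_eq_add_pow, sub_add_cancel, one_pow, one_mul]

theorem sum_powerset_disjoint_not_disjoint_weight {R : Type*} [CommRing R] (hG : G ⊆ A)
    (hH : H ⊆ A) (hGH : Disjoint G H) (s : R) :
    ∑ S ∈ A.powerset with (Disjoint S G ∧ ¬Disjoint S H), (1 - s) ^ #S * s ^ (#A - #S) =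
      s ^ #G * (1 - s ^ #H) := by
  have hmiss := sum_powerset_disjoint_weight hG s
  have hmiss_both := sum_powerset_disjoint_weight (Finset.union_subset hG hH) s
  rw [← Finset.sum_filter_add_sum_filter_not _ (Disjoint · H), Finset.filter_filter,
    Finset.filter_filter] at hmiss
  simp only [Finset.disjoint_union_right] at hmiss_both
  rw [Finset.card_union_of_disjoint hGH, pow_add] at hmiss_both
  linear_combination hmiss - hmiss_both

/-- Include each point of `A` independently with probability `1 - s`. -/
theorem exists_subset_disjoint_not_disjoint {P : Finset κ} {G H : κ → Finset α} {w : κ → ℝ}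
    {s p : ℝ} (hs₀ : 0 ≤ s) (hs₁ : s ≤ 1) (hw : ∀ k ∈ P, 0 ≤ w k)
    (h : ∀ k ∈ P, 0 < w k → G k ⊆ A ∧ H k ⊆ A ∧ Disjoint (G k) (H k) ∧
      p ≤ s ^ #(G k) * (1 - s ^ #(H k))) :
    ∃ S ⊆ A, p * ∑ k ∈ P, w k ≤ ∑ k ∈ P with (Disjoint S (G k) ∧ ¬Disjoint S (H k)), w k := by
  obtain ⟨S, hS, hle⟩ := exists_mul_sum_le_sum_filter (T := A.powerset)
    (μ := fun S => (1 - s) ^ #S * s ^ (#A - #S)) (p := p)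
    (fun S k => Disjoint S (G k) ∧ ¬Disjoint S (H k))
    (fun S _ => mul_nonneg (pow_nonneg (sub_nonneg.2 hs₁) _) (pow_nonneg hs₀ _))
    (by rw [Finset.sum_pow_mul_eq_add_pow, sub_add_cancel, one_pow]) hw fun k hk hk₀ => by
      obtain ⟨hG, hH, hGH, hp⟩ := h k hk hk₀
      rwa [sum_powerset_disjoint_not_disjoint_weight hG hH hGH]
  exact ⟨S, Finset.mem_powerset.1 hS, hle⟩

theorem exists_subsets_disjoint_not_disjoint {Q : Finset κ} {J : Finset ι}
    {G H : κ → ι → Finset α} {w : κ → ι → ℝ} {s : ι → ℝ} {p θ : ℝ} (hs₀ : ∀ j, 0 ≤ s j)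
    (hs₁ : ∀ j, s j ≤ 1) (hθ : 0 ≤ θ) (hw : ∀ k ∈ Q, ∀ j, 0 ≤ w k j)
    (hw_sum : ∀ k ∈ Q, ∑ j ∈ J, w k j = 1)
    (h : ∀ j, ∀ k ∈ Q, 0 < w k j → G k j ⊆ A ∧ H k j ⊆ A ∧ Disjoint (G k j) (H k j) ∧
      p ≤ s j ^ #(G k j) * (1 - s j ^ #(H k j))) :
    ∃ S : ι → Finset α, (∀ j, S j ⊆ A) ∧ (p - θ) * #Q ≤
      #{k ∈ Q | θ ≤ ∑ j ∈ J with (Disjoint (S j) (G k j) ∧ ¬Disjoint (S j) (H k j)), w k j} := by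
  choose S hSA hS using fun j => exists_subset_disjoint_not_disjoint (hs₀ j) (hs₁ j)
    (fun k hk => hw k hk j) (h j)
  refine ⟨S, hSA, ?_⟩
  set Z : κ → ℝ := fun k =>
    ∑ j ∈ J with (Disjoint (S j) (G k j) ∧ ¬Disjoint (S j) (H k j)), w k j
  have hZ_le_one : ∀ k ∈ Q, Z k ≤ 1 := fun k hk => hw_sum k hk ▸
    Finset.sum_le_sum_of_subset_of_nonneg (Finset.filter_subset _ _) fun j _ _ => hw k hk j
  have hZ_sum : p * #Q ≤ ∑ k ∈ Q, Z k :=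
    calc p * #Q = p * ∑ k ∈ Q, ∑ j ∈ J, w k j := by
          rw [Finset.sum_congr rfl hw_sum, Finset.sum_const, nsmul_one]
      _ = ∑ j ∈ J, p * ∑ k ∈ Q, w k j := by rw [Finset.sum_comm, Finset.mul_sum]
      _ ≤ ∑ j ∈ J, ∑ k ∈ Q with (Disjoint (S j) (G k j) ∧ ¬Disjoint (S j) (H k j)), w k j :=
        Finset.sum_le_sum fun j _ => hS j
      _ = ∑ k ∈ Q, Z k := by
        simp only [Z, Finset.sum_filter]
        exact Finset.sum_comm
  linarith [sum_le_card_mul_add_card_filter hθ hZ_le_one]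

/-- With `c ^ (1 / β)` the probability of omitting a point, a set of at most `β` points is missed
with probability at least `c`. -/
theorem mul_one_sub_rpow_le_pow_mul_one_sub_pow {c β θ : ℝ} {g h : ℕ} (hc₀ : 0 < c) (hc₁ : c ≤ 1)
    (hβ : 0 < β) (hg : g ≤ β) (hh : β * θ ≤ h) :
    c * (1 - c ^ θ) ≤ (c ^ β⁻¹) ^ g * (1 - (c ^ β⁻¹) ^ h) := by
  have hpow : ∀ k : ℕ, (c ^ β⁻¹) ^ k = c ^ (k / β) := fun k => by
    rw [← Real.rpow_natCast, ← Real.rpow_mul hc₀.le, div_eq_inv_mul]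
  have hmiss : c ≤ (c ^ β⁻¹) ^ g := by
    rw [hpow]
    exact Real.self_le_rpow_of_le_one hc₀.le hc₁ ((div_le_one hβ).2 hg)
  have hhit : (c ^ β⁻¹) ^ h ≤ c ^ θ := by
    rw [hpow]
    exact Real.rpow_le_rpow_of_exponent_ge hc₀ hc₁ ((le_div_iff₀' hβ).2 hh)
  calc c * (1 - c ^ θ) ≤ c * (1 - (c ^ β⁻¹) ^ h) := by gcongr
    _ ≤ (c ^ β⁻¹) ^ g * (1 - (c ^ β⁻¹) ^ h) := by
      gcongr
      exact sub_nonneg.2 (pow_le_one₀ (by positivity)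
        (Real.rpow_le_one hc₀.le hc₁ (inv_nonneg.2 hβ.le)))

end RandomSubset

section RandomSigns

variable {ι κ X : Type*} [DecidableEq ι] {J S : Finset ι} {a : ι}

/-- The sum of `t` over `J` with the sign `+` on `S` and `-` off `S`: a Rademacher sum as `S` runs
over the subsets of `J`. -/
noncomputable def signedSum (J S : Finset ι) (t : ι → ℝ) : ℝ :=
  ∑ j ∈ J, if j ∈ S then t j else -t j

theorem signedSum_sub (J S : Finset ι) (t t' : ι → ℝ) :
    signedSum J S (t - t') = signedSum J S t - signedSum J S t' := by
  simp only [signedSum, ← Finset.sum_sub_distrib, Pi.sub_apply]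
  refine Finset.sum_congr rfl fun j _ => ?_
  split_ifs <;> ring

theorem abs_signedSum_le (J S : Finset ι) (t : ι → ℝ) : |signedSum J S t| ≤ ∑ j ∈ J, |t j| :=
  (Finset.abs_sum_le_sum_abs _ _).trans_eq <| Finset.sum_congr rfl fun j _ => by
    split_ifs <;> simp

theorem lipschitzWith_signedSum [PseudoMetricSpace X] (J S : Finset ι) {f : ι → X → ℝ}
    (hf : ∀ j ∈ J, LipschitzWith 1 (f j)) :
    LipschitzWith #J fun x => signedSum J S fun j => f j x := by
  refine .of_dist_le_mul fun x y => ?_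
  rw [Real.dist_eq, ← signedSum_sub]
  calc _ ≤ ∑ j ∈ J, |f j x - f j y| := abs_signedSum_le J S _
    _ ≤ #J • dist x y := Finset.sum_le_card_nsmul _ _ _ fun j hj => by
      simpa [Real.dist_eq] using (hf j hj).dist_le_mul x y
    _ = _ := by simp

theorem signedSum_insert_of_notMem (ha : a ∉ J) (hS : S ⊆ J) (t : ι → ℝ) :
    signedSum (insert a J) S t = signedSum J S t - t a := by
  rw [signedSum, Finset.sum_insert ha, if_neg fun h => ha (hS h), signedSum, neg_add_eq_sub]

theorem signedSum_insert_insert (ha : a ∉ J) (t : ι → ℝ) :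
    signedSum (insert a J) (insert a S) t = signedSum J S t + t a := by
  rw [signedSum, Finset.sum_insert ha, if_pos (Finset.mem_insert_self a S), signedSum, add_comm]
  congr 1
  refine Finset.sum_congr rfl fun j hj => ?_
  simp [show j ≠ a from fun h => ha (h ▸ hj)]

theorem sum_powerset_insert_signedSum_pow (ha : a ∉ J) (t : ι → ℝ) (m : ℕ) :
    ∑ S ∈ (insert a J).powerset, signedSum (insert a J) S t ^ m =
      ∑ S ∈ J.powerset, ((signedSum J S t - t a) ^ m + (signedSum J S t + t a) ^ m) := by
  rw [Finset.sum_powerset_insert ha, ← Finset.sum_add_distrib]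
  refine Finset.sum_congr rfl fun S hS => ?_
  rw [signedSum_insert_of_notMem ha (Finset.mem_powerset.1 hS), signedSum_insert_insert ha]

theorem sum_signedSum_sq (J : Finset ι) (t : ι → ℝ) :
    ∑ S ∈ J.powerset, signedSum J S t ^ 2 = 2 ^ #J * ∑ j ∈ J, t j ^ 2 := by
  induction J using Finset.induction_on with
  | empty => simp [signedSum]
  | insert a J ha ih =>
    have hexpand : ∀ S, (signedSum J S t - t a) ^ 2 + (signedSum J S t + t a) ^ 2 =
        2 * signedSum J S t ^ 2 + 2 * t a ^ 2 := fun S => by ring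
    simp only [sum_powerset_insert_signedSum_pow ha, hexpand, Finset.sum_add_distrib,
      ← Finset.mul_sum, ih, Finset.sum_const, Finset.card_powerset, Finset.sum_insert ha,
      Finset.card_insert_of_notMem ha, nsmul_eq_mul]
    push_cast
    ring

theorem sum_signedSum_pow_four_le (J : Finset ι) (t : ι → ℝ) :
    ∑ S ∈ J.powerset, signedSum J S t ^ 4 ≤ 2 ^ #J * (3 * (∑ j ∈ J, t j ^ 2) ^ 2) := by
  induction J using Finset.induction_on with
  | empty => simp [signedSum]
  | insert a J ha ih =>
    have hexpand : ∀ S, (signedSum J S t - t a) ^ 4 + (signedSum J S t + t a) ^ 4 =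
        2 * signedSum J S t ^ 4 + 12 * t a ^ 2 * signedSum J S t ^ 2 + 2 * t a ^ 4 :=
      fun S => by ring
    simp only [sum_powerset_insert_signedSum_pow ha, hexpand, Finset.sum_add_distrib,
      ← Finset.mul_sum, sum_signedSum_sq, Finset.sum_const, Finset.card_powerset,
      Finset.sum_insert ha, Finset.card_insert_of_notMem ha, nsmul_eq_mul]
    push_cast
    have : 0 ≤ 2 ^ #J * t a ^ 4 := by positivity
    rw [pow_succ (2 : ℝ)]
    linarith

theorem mul_two_pow_card_le_card_filter_signedSum_sq (J : Finset ι) (t : ι → ℝ) :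
    (3 / 10 : ℝ) * 2 ^ #J ≤
      #{S ∈ J.powerset | (∑ j ∈ J, t j ^ 2) / 20 ≤ signedSum J S t ^ 2} := by
  have hV : 0 ≤ ∑ j ∈ J, t j ^ 2 := Finset.sum_nonneg fun j _ => sq_nonneg _
  have hsq := sum_signedSum_sq J t
  have hfour := sum_signedSum_pow_four_le J t
  set V := ∑ j ∈ J, t j ^ 2
  set N := #{S ∈ J.powerset | V / 20 ≤ signedSum J S t ^ 2} with hN
  rcases hV.eq_or_lt with hV₀ | hV₀
  · have hN_eq : (N : ℝ) = 2 ^ #J := by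
      rw [hN, ← hV₀, zero_div, Finset.filter_true_of_mem fun S _ => sq_nonneg _,
        Finset.card_powerset, Nat.cast_pow, Nat.cast_ofNat]
    rw [hN_eq]
    linarith [pow_pos (two_pos (α := ℝ)) #J]
  have hcard : (#J.powerset : ℝ) = 2 ^ #J := by simp
  have hPZ : (2 ^ #J * V - 2 ^ #J * (V / 20)) ^ 2 ≤ N * (2 ^ #J * (3 * V ^ 2)) := by
    have h := sq_sum_sub_card_mul_le_card_filter_mul_sum_sq (s := J.powerset)
      (u := fun S => signedSum J S t ^ 2) (θ := V / 20) (by positivity) (by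
        rw [hsq, hcard]
        gcongr
        linarith)
    simp only [hsq, hcard, ← pow_mul] at h
    exact h.trans (by gcongr)
  have hpos : 0 < 2 ^ #J * V ^ 2 := by positivity
  refine le_of_mul_le_mul_right ?_ hpos
  nlinarith [mul_pos (pow_pos (two_pos (α := ℝ)) #J) hpos]

theorem exists_signs (J : Finset ι) (Q : Finset κ) (t : κ → ι → ℝ) :
    ∃ S : Finset ι, (3 / 10 : ℝ) * #Q ≤
      #{k ∈ Q | (∑ j ∈ J, t k j ^ 2) / 20 ≤ signedSum J S (t k) ^ 2} := by
  obtain ⟨S, -, hS⟩ := exists_mul_sum_le_sum_filter (T := J.powerset) (P := Q)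
    (μ := fun _ => (2 ^ #J : ℝ)⁻¹) (w := fun _ => 1) (p := 3 / 10)
    (fun S k => (∑ j ∈ J, t k j ^ 2) / 20 ≤ signedSum J S (t k) ^ 2)
    (fun _ _ => by positivity) (by simp) (fun _ _ => zero_le_one) fun k _ _ => by
      rw [Finset.sum_const, nsmul_eq_mul, le_mul_inv_iff₀ (by positivity)]
      exact mul_two_pow_card_le_card_filter_signedSum_sq J (t k)
  exact ⟨S, by simpa using hS⟩

end RandomSigns

section RandomDistances

open Metric

section PseudoMetricSpace

variable {X : Type*} [PseudoMetricSpace X] {A G H : Finset X} {x y : X}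

theorem exists_threshold_radius {z : X} {β : ℝ} (hβ : 0 < β) (hA : β ≤ #A) :
    ∃ ρ : ℝ, 0 ≤ ρ ∧ #{a ∈ A | dist a z < ρ} < β ∧ β ≤ #{a ∈ A | dist a z ≤ ρ} := by
  set T := {b ∈ A | β ≤ #{a ∈ A | dist a z ≤ dist b z}}
  have hT : ∀ B ⊆ A, β ≤ #B → ∃ b ∈ B, b ∈ T := by
    intro B hB hcard
    have hne : B.Nonempty := Finset.card_pos.1 (by exact_mod_cast hβ.trans_le hcard)
    obtain ⟨b, hb, hb_max⟩ := B.exists_max_image (fun a => dist a z) hne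
    refine ⟨b, hb, Finset.mem_filter.2 ⟨hB hb, hcard.trans ?_⟩⟩
    exact_mod_cast Finset.card_le_card fun a ha => Finset.mem_filter.2 ⟨hB ha, hb_max a ha⟩
  obtain ⟨b₀, -, hb₀⟩ := hT A subset_rfl hA
  obtain ⟨b, hb, hb_min⟩ := T.exists_min_image (fun a => dist a z) ⟨b₀, hb₀⟩
  refine ⟨dist b z, dist_nonneg, ?_, (Finset.mem_filter.1 hb).2⟩
  by_contra! hcon
  obtain ⟨c, hc, hcT⟩ := hT _ (Finset.filter_subset _ _) hcon
  exact (Finset.mem_filter.1 hc).2.not_ge (hb_min c hcT)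

theorem exists_threshold_radius_pair (A : Finset X) (x y : X) {β D : ℝ} (hβ : 0 < β)
    (hD : 0 ≤ D) :
    ∃ ρ : ℝ, 0 ≤ ρ ∧ ρ ≤ D ∧ (#{a ∈ A | dist a x < ρ} < β ∨ #{a ∈ A | dist a y < ρ} < β) ∧
      (ρ = D ∨ β ≤ #{a ∈ A | dist a x ≤ ρ} ∧ β ≤ #{a ∈ A | dist a y ≤ ρ}) := by
  have hlt_mono : ∀ z : X, ∀ {r s : ℝ}, r ≤ s →
      (#{a ∈ A | dist a z < r} : ℝ) ≤ #{a ∈ A | dist a z < s} := fun z r s h => by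
    gcongr
  have hle_mono : ∀ z : X, ∀ {r s : ℝ}, r ≤ s →
      (#{a ∈ A | dist a z ≤ r} : ℝ) ≤ #{a ∈ A | dist a z ≤ s} := fun z r s h => by
    gcongr
  rcases lt_or_ge (#A : ℝ) β with hA | hA
  · refine ⟨D, hD, le_rfl, .inl (lt_of_le_of_lt ?_ hA), .inl rfl⟩
    exact_mod_cast Finset.card_filter_le _ _
  obtain ⟨r, hr₀, hr_lt, hr_le⟩ := exists_threshold_radius (z := x) hβ hA
  obtain ⟨s, -, hs_lt, hs_le⟩ := exists_threshold_radius (z := y) hβ hA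
  refine ⟨min D (max r s), le_min hD (hr₀.trans (le_max_left _ _)), min_le_left _ _, ?_, ?_⟩
  · rcases le_total r s with h | h
    · exact .inr ((hlt_mono y (by simp [h])).trans_lt hs_lt)
    · exact .inl ((hlt_mono x (by simp [h])).trans_lt hr_lt)
  · rcases le_total D (max r s) with h | h
    · exact .inl (min_eq_left h)
    · rw [min_eq_right h]
      exact .inr ⟨hr_le.trans (hle_mono x (le_max_left _ _)),
        hs_le.trans (hle_mono y (le_max_right _ _))⟩

theorem exists_threshold_radii (hx : x ∈ A) (hy : y ∈ A) {b : ℝ} (hb : 0 < b) {J : ℕ}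
    (hJ : #A < b ^ J) :
    ∃ ρ : ℕ → ℝ, ρ 0 = 0 ∧ ρ J = dist x y / 2 ∧ (∀ j, ρ j ≤ dist x y / 2) ∧
      (∀ j, #{a ∈ A | dist a x < ρ j} < b ^ j ∨ #{a ∈ A | dist a y < ρ j} < b ^ j) ∧
      ∀ j, ρ j = dist x y / 2 ∨
        b ^ j ≤ #{a ∈ A | dist a x ≤ ρ j} ∧ b ^ j ≤ #{a ∈ A | dist a y ≤ ρ j} := by
  choose ρ hρ₀ hρD hρ_lt hρ_le using fun j : ℕ =>
    exists_threshold_radius_pair A x y (pow_pos hb j) (by positivity : 0 ≤ dist x y / 2)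
  refine ⟨ρ, le_antisymm ?_ (hρ₀ 0), (hρ_le J).resolve_right fun h => ?_, hρD, hρ_lt, hρ_le⟩
  · have hnonpos : ∀ z ∈ A, #{a ∈ A | dist a z < ρ 0} < b ^ 0 → ρ 0 ≤ 0 := fun z hz hlt => by
      rw [pow_zero, Nat.cast_lt_one, Finset.card_eq_zero] at hlt
      simpa using Finset.filter_eq_empty_iff.1 hlt hz
    exact (hρ_lt 0).elim (hnonpos x hx) (hnonpos y hy)
  · exact (h.1.trans (mod_cast Finset.card_filter_le _ _)).not_gt hJ

/-- One scale of Bourgain's argument: every subset of `A` which misses `G` and hits `H` tells `x`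
from `y` by at least `δ`. The bounds `g` on `G` and `h` on `H` control how likely a random subset
is to do so. -/
structure IsBourgainPair (A : Finset X) (x y : X) (g h δ : ℝ) (G H : Finset X) : Prop where
  left_subset : G ⊆ A
  right_subset : H ⊆ A
  disjoint : Disjoint G H
  card_left_le : #G ≤ g
  le_card_right : h ≤ #H
  le_abs_sub : ∀ S ⊆ A, Disjoint S G → ¬Disjoint S H →
    δ ≤ |infDist x (S : Set X) - infDist y (S : Set X)|

theorem IsBourgainPair.symm {g h δ : ℝ} (hp : IsBourgainPair A x y g h δ G H) :
    IsBourgainPair A y x g h δ G H where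
  __ := hp
  le_abs_sub S hS hG hH := abs_sub_comm (infDist y (S : Set X)) _ ▸ hp.le_abs_sub S hS hG hH

theorem isBourgainPair_filter_dist {g h r s : ℝ} (hrs : r + s ≤ dist x y)
    (hg : #{a ∈ A | dist a x < r} ≤ g) (hh : h ≤ #{a ∈ A | dist a y ≤ s}) :
    IsBourgainPair A x y g h (r - s) {a ∈ A | dist a x < r} {a ∈ A | dist a y ≤ s} where
  left_subset := Finset.filter_subset _ _
  right_subset := Finset.filter_subset _ _
  disjoint := Finset.disjoint_filter.2 fun a _ hax hay => by
    linarith [dist_triangle_left x y a]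
  card_left_le := hg
  le_card_right := hh
  le_abs_sub S hS hG hH := by
    obtain ⟨b, hbS, hb⟩ := Finset.not_disjoint_iff.1 hH
    have hy : infDist y S ≤ s := (infDist_le_dist_of_mem (Finset.mem_coe.2 hbS)).trans
      (dist_comm y b ▸ (Finset.mem_filter.1 hb).2)
    have hx : r ≤ infDist x S := (le_infDist ⟨b, hbS⟩).2 fun a ha => by
      by_contra! hlt
      exact Finset.disjoint_left.1 hG ha (Finset.mem_filter.2 ⟨hS ha, dist_comm x a ▸ hlt⟩)
    exact (sub_le_sub hx hy).trans (le_abs_self _)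

theorem exists_isBourgainPair (hx : x ∈ A) (hy : y ∈ A) {b : ℝ} (hb : 0 < b) {J : ℕ}
    (hJ : #A < b ^ J) :
    ∃ (δ : ℕ → ℝ) (G H : ℕ → Finset X), (∀ j, 0 ≤ δ j) ∧
      dist x y / 2 ≤ ∑ j ∈ Finset.range J, δ j ∧
      ∀ j, 0 < δ j → IsBourgainPair A x y (b ^ (j + 1)) (b ^ j) (δ j) (G j) (H j) := by
  obtain ⟨ρ, hρ_zero, hρ_last, hρD, hρ_lt, hρ_le⟩ := exists_threshold_radii hx hy hb hJ
  have hpair : ∀ j, ∃ G H, ρ j < ρ (j + 1) →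
      IsBourgainPair A x y (b ^ (j + 1)) (b ^ j) (ρ (j + 1) - ρ j) G H := by
    intro j
    have hsum : ρ (j + 1) + ρ j ≤ dist x y := by linarith [hρD j, hρD (j + 1)]
    have hcard : ρ j < ρ (j + 1) →
        b ^ j ≤ #{a ∈ A | dist a x ≤ ρ j} ∧ b ^ j ≤ #{a ∈ A | dist a y ≤ ρ j} :=
      fun hlt => (hρ_le j).resolve_left (hlt.trans_le (hρD _)).ne
    rcases hρ_lt (j + 1) with h | h
    · exact ⟨_, _, fun hlt => isBourgainPair_filter_dist hsum h.le (hcard hlt).2⟩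
    · exact ⟨_, _, fun hlt =>
        (isBourgainPair_filter_dist (dist_comm x y ▸ hsum) h.le (hcard hlt).1).symm⟩
  choose G H hGH using hpair
  refine ⟨fun j => max 0 (ρ (j + 1) - ρ j), G, H, fun j => le_max_left _ _, ?_, fun j hj => ?_⟩
  · calc dist x y / 2 = ∑ j ∈ Finset.range J, (ρ (j + 1) - ρ j) := by
          rw [Finset.sum_range_sub, hρ_last, hρ_zero, sub_zero]
      _ ≤ ∑ j ∈ Finset.range J, max 0 (ρ (j + 1) - ρ j) :=
        Finset.sum_le_sum fun j _ => le_max_right _ _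
  · have hlt : 0 < ρ (j + 1) - ρ j := by simpa using hj
    simpa only [max_eq_right hlt.le] using hGH j (sub_pos.1 hlt)

theorem IsBourgainPair.le_pow_mul_one_sub_pow {δ : ℝ} {j : ℕ}
    (hp : IsBourgainPair A x y ((3 / 2) ^ (j + 1)) ((3 / 2) ^ j) δ G H) :
    189 / 1024 ≤ ((27 / 64 : ℝ) ^ ((3 / 2 : ℝ) ^ (j + 1))⁻¹) ^ #G *
      (1 - ((27 / 64 : ℝ) ^ ((3 / 2 : ℝ) ^ (j + 1))⁻¹) ^ #H) :=
  calc (189 / 1024 : ℝ) = 27 / 64 * (1 - (27 / 64) ^ (2 / 3 : ℝ)) := by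
        rw [show (27 / 64 : ℝ) = (3 / 4) ^ (3 : ℝ) by norm_num, ← Real.rpow_mul (by norm_num)]
        norm_num
    _ ≤ _ := mul_one_sub_rpow_le_pow_mul_one_sub_pow (by norm_num) (by norm_num) (by positivity)
      hp.card_left_le (le_trans (le_of_eq (by ring)) hp.le_card_right)

theorem sum_sq_le_sum_sq_infDist_sub {ι : Type*} {J : Finset ι} {g h δ : ι → ℝ}
    {G H S : ι → Finset X} (hδ : ∀ j, 0 ≤ δ j)
    (hp : ∀ j, 0 < δ j → IsBourgainPair A x y (g j) (h j) (δ j) (G j) (H j)) (hS : ∀ j, S j ⊆ A)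
    [∀ j, Decidable (Disjoint (S j) (G j) ∧ ¬Disjoint (S j) (H j))] :
    ∑ j ∈ J with (Disjoint (S j) (G j) ∧ ¬Disjoint (S j) (H j)), δ j ^ 2 ≤
      ∑ j ∈ J, (infDist x (S j : Set X) - infDist y (S j : Set X)) ^ 2 := by
  refine (Finset.sum_le_sum fun j hj => ?_).trans <|
    Finset.sum_le_sum_of_subset_of_nonneg (Finset.filter_subset _ _) fun _ _ _ => sq_nonneg _
  obtain ⟨-, hG, hH⟩ := Finset.mem_filter.1 hj
  rcases (hδ j).eq_or_lt with hδj | hδj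
  · rw [← hδj, zero_pow two_ne_zero]
    exact sq_nonneg _
  · exact sq_le_sq.2 ((abs_of_pos hδj).trans_le ((hp j hδj).le_abs_sub (S j) (hS j) hG hH))

end PseudoMetricSpace

variable {X : Type*} [MetricSpace X] {A : Finset X} {J : ℕ}

open Classical in
/-- Scale `j` detects the pair `k` with weight `δ k j ^ 2 / ∑ i, δ k i ^ 2`, and the random set of
scale `j` realises this with probability at least `189 / 1024`. -/
theorem exists_sets_le_sum_sq_infDist_sub (hA : #A < (3 / 2 : ℝ) ^ J) {Q : Finset (X × X)}
    (hQ : Q ⊆ A.offDiag) :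
    ∃ S : ℕ → Set X, (0.18 : ℝ) * #Q ≤ #{k ∈ Q | dist k.1 k.2 ^ 2 / (1000 * J) ≤
      ∑ j ∈ Finset.range J, (infDist k.1 (S j) - infDist k.2 (S j)) ^ 2} := by
  choose! δ G H hδ₀ hδ_sum hGH using fun k (hk : k ∈ Q) =>
    exists_isBourgainPair (Finset.mem_offDiag.1 (hQ hk)).1 (Finset.mem_offDiag.1 (hQ hk)).2.1
      (by norm_num : (0 : ℝ) < 3 / 2) hA
  set D : X × X → ℝ := fun k => ∑ j ∈ Finset.range J, δ k j ^ 2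
  have hD : ∀ k ∈ Q, (dist k.1 k.2 / 2) ^ 2 ≤ J * D k := fun k hk =>
    calc (dist k.1 k.2 / 2) ^ 2 ≤ (∑ j ∈ Finset.range J, δ k j) ^ 2 := by
          gcongr
          exact hδ_sum k hk
      _ ≤ #(Finset.range J) * D k := sq_sum_le_card_mul_sum_sq
      _ = J * D k := by rw [Finset.card_range]
  have hD_pos : ∀ k ∈ Q, 0 < D k := fun k hk => by
    have : 0 < dist k.1 k.2 := dist_pos.2 (Finset.mem_offDiag.1 (hQ hk)).2.2
    exact pos_of_mul_pos_right ((by positivity : 0 < (dist k.1 k.2 / 2) ^ 2).trans_le (hD k hk))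
      J.cast_nonneg
  obtain ⟨S, hSA, hS⟩ := exists_subsets_disjoint_not_disjoint (A := A) (G := G) (H := H)
    (J := Finset.range J) (w := fun k j => δ k j ^ 2 / D k) (p := 189 / 1024) (θ := 1 / 250)
    (s := fun j => (27 / 64 : ℝ) ^ ((3 / 2 : ℝ) ^ (j + 1))⁻¹) (fun j => by positivity)
    (fun j => Real.rpow_le_one (by norm_num) (by norm_num) (by positivity)) (by norm_num)
    (fun k hk j => div_nonneg (sq_nonneg _) (hD_pos k hk).le)
    (fun k hk => by rw [← Finset.sum_div]; exact div_self (hD_pos k hk).ne') fun j k hk hw => by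
      have hp := hGH k hk j ((hδ₀ k hk j).lt_of_ne fun h => by simp [← h] at hw)
      exact ⟨hp.left_subset, hp.right_subset, hp.disjoint, hp.le_pow_mul_one_sub_pow⟩
  refine ⟨fun j => S j, le_trans (by gcongr; norm_num) (hS.trans <| Nat.cast_le.2 <|
    Finset.card_le_card <| Finset.monotone_filter_right _ fun k hk hkS => ?_)⟩
  rw [← Finset.sum_div, le_div_iff₀ (hD_pos k hk)] at hkS
  calc dist k.1 k.2 ^ 2 / (1000 * J) = (dist k.1 k.2 / 2) ^ 2 / J / 250 := by ring
    _ ≤ D k / 250 := by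
      gcongr
      exact div_le_of_le_mul₀ J.cast_nonneg (hD_pos k hk).le (mul_comm (D k) _ ▸ hD k hk)
    _ = 1 / 250 * D k := by ring
    _ ≤ ∑ j ∈ Finset.range J, (infDist k.1 (S j) - infDist k.2 (S j)) ^ 2 :=
      hkS.trans (sum_sq_le_sum_sq_infDist_sub (hδ₀ k hk) (hGH k hk) hSA)

theorem exists_lipschitzWith_le_sq_sub (hA : #A < (3 / 2 : ℝ) ^ J) {Q : Finset (X × X)}
    (hQ : Q ⊆ A.offDiag) :
    ∃ F : X → ℝ, LipschitzWith J F ∧ (1 - 0.946 : ℝ) * #Q ≤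
      #{k ∈ Q | dist k.1 k.2 ^ 2 / (20000 * J) ≤ (F k.1 - F k.2) ^ 2} := by
  obtain ⟨S, hS⟩ := exists_sets_le_sum_sq_infDist_sub hA hQ
  set R := {k ∈ Q | dist k.1 k.2 ^ 2 / (1000 * J) ≤
    ∑ j ∈ Finset.range J, (infDist k.1 (S j) - infDist k.2 (S j)) ^ 2} with hR
  obtain ⟨σ, hσ⟩ := exists_signs (Finset.range J) R
    fun k => (fun j => infDist k.1 (S j)) - fun j => infDist k.2 (S j)
  refine ⟨fun x => signedSum (Finset.range J) σ fun j => infDist x (S j), ?_, ?_⟩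
  · simpa using lipschitzWith_signedSum (Finset.range J) σ fun j _ => lipschitz_infDist_pt (S j)
  calc (1 - 0.946 : ℝ) * #Q = 3 / 10 * (0.18 * #Q) := by ring
    _ ≤ 3 / 10 * #R := by gcongr
    _ ≤ _ := hσ
    _ ≤ _ := by
      rw [hR, Finset.filter_filter]
      refine Nat.cast_le.2 <| Finset.card_le_card <|
        Finset.monotone_filter_right _ fun k _ ⟨hk, hkσ⟩ => ?_
      rw [signedSum_sub] at hkσ
      refine le_trans ?_ hkσ
      calc dist k.1 k.2 ^ 2 / (20000 * J) = dist k.1 k.2 ^ 2 / (1000 * J) / 20 := by ring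
        _ ≤ _ := by
          gcongr
          exact hk

theorem exists_lipschitzWith_dist_le_mul_dist {m : ℕ} (hA : #A < (3 / 2 : ℝ) ^ J)
    (hm : (0.946 : ℝ) ^ m * #A.offDiag < 1) :
    ∃ F : X → Fin m → ℝ, LipschitzWith J F ∧
      ∀ x ∈ A, ∀ y ∈ A, dist x y ≤ √(20000 * J) * dist (F x) (F y) := by
  obtain ⟨φ, hφ⟩ := exists_greedy_cover
    (fun (F : {F : X → ℝ // LipschitzWith J F}) k =>
      dist k.1 k.2 ^ 2 / (20000 * J) ≤ (F.1 k.1 - F.1 k.2) ^ 2) (by norm_num)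
    (fun Q hQ => by
      obtain ⟨F, hF, hFQ⟩ := exists_lipschitzWith_le_sq_sub hA hQ
      refine ⟨⟨F, hF⟩, ?_⟩
      convert hFQ) hm
  refine ⟨fun x i => (φ i).1 x, .of_dist_le_mul fun x y => (dist_pi_le_iff (by positivity)).2
    fun i => (φ i).2.dist_le_mul x y, fun x hx y hy => ?_⟩
  rcases eq_or_ne x y with rfl | hxy
  · simp
  have hJ : 0 < J := Nat.pos_of_ne_zero fun hJ => by
    rw [hJ, pow_zero, Nat.cast_lt_one] at hA
    exact (Finset.card_pos.2 ⟨x, hx⟩).ne' hA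
  obtain ⟨i, hi⟩ := hφ (x, y) (Finset.mem_offDiag.2 ⟨hx, hy, hxy⟩)
  rw [div_le_iff₀' (by positivity), ← sq_abs (_ - _)] at hi
  calc dist x y ≤ √(20000 * J * dist ((φ i).1 x) ((φ i).1 y) ^ 2) := Real.le_sqrt_of_sq_le hi
    _ = √(20000 * J) * dist ((φ i).1 x) ((φ i).1 y) := by
      rw [Real.sqrt_mul (by positivity), Real.sqrt_sq dist_nonneg]
    _ ≤ √(20000 * J) * dist (fun i => (φ i).1 x) (fun i => (φ i).1 y) := by
      gcongr
      exact dist_le_pi_dist (fun i => (φ i).1 x) (fun i => (φ i).1 y) i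

theorem exists_lipschitzWith_two_mul {n : ℕ} (hn : n ≠ 0) (hA : #A ≤ 2 ^ n) :
    ∃ F : X → Fin (26 * n) → ℝ, LipschitzWith (2 * n) F ∧
      ∀ x ∈ A, ∀ y ∈ A, dist x y ≤ 200 * √n * dist (F x) (F y) := by
  have hAJ : #A < (3 / 2 : ℝ) ^ (2 * n) :=
    calc (#A : ℝ) ≤ 2 ^ n := mod_cast hA
      _ < (9 / 4) ^ n := pow_lt_pow_left₀ (by norm_num) (by norm_num) hn
      _ = (3 / 2) ^ (2 * n) := by rw [pow_mul]; norm_num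
  have hoffDiag : (#A.offDiag : ℝ) ≤ 4 ^ n := by
    have : #A.offDiag ≤ 2 ^ n * 2 ^ n :=
      A.offDiag_card ▸ (Nat.sub_le _ _).trans (Nat.mul_le_mul hA hA)
    rw [← mul_pow] at this
    exact_mod_cast this
  have hm : (0.946 : ℝ) ^ (26 * n) * #A.offDiag < 1 :=
    calc (0.946 : ℝ) ^ (26 * n) * #A.offDiag ≤ 0.946 ^ (26 * n) * 4 ^ n := by gcongr
      _ = (0.946 ^ 26 * 4) ^ n := by rw [pow_mul, mul_pow]
      _ < 1 := pow_lt_one₀ (by norm_num) (by norm_num) hn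
  obtain ⟨F, hF, hFA⟩ := exists_lipschitzWith_dist_le_mul_dist hAJ hm
  have hsqrt : √(20000 * ↑(2 * n)) = 200 * √n := by
    rw [show (20000 * ↑(2 * n) : ℝ) = 200 ^ 2 * n by push_cast; ring,
      Real.sqrt_mul (by norm_num), Real.sqrt_sq (by norm_num)]
  exact ⟨F, by exact_mod_cast hF, hsqrt ▸ hFA⟩

end RandomDistances

section LipschitzExtension
open MeasureTheory Metric Module

theorem exists_simpleFunc_dist_eq_infDist {V : Type*} [PseudoMetricSpace V] [MeasurableSpace V]
    [OpensMeasurableSpace V] {S : Finset V} (hS : S.Nonempty) :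
    ∃ π : SimpleFunc V V, ∀ z, π z ∈ S ∧ dist z (π z) = infDist z S := by
  obtain ⟨e, he⟩ := S.countable_toSet.exists_eq_range hS
  have he_mem : ∀ k, e k ∈ S := fun k => Finset.mem_coe.1 (he ▸ Set.mem_range_self k)
  choose! k hk using fun s (hs : s ∈ S) => (he ▸ Finset.mem_coe.2 hs : s ∈ Set.range e)
  have hπ_mem : ∀ z, SimpleFunc.nearestPt e (S.sup k) z ∈ S := fun z => he_mem _
  refine ⟨SimpleFunc.nearestPt e (S.sup k), fun z => ⟨hπ_mem z, le_antisymm ?_ ?_⟩⟩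
  · refine (le_infDist hS).2 fun s hs => ?_
    have h := SimpleFunc.edist_nearestPt_le e z (Finset.le_sup hs : k s ≤ S.sup k)
    rwa [hk s hs, edist_dist, edist_dist, ENNReal.ofReal_le_ofReal_iff dist_nonneg, dist_comm,
      dist_comm s] at h
  · exact infDist_le_dist_of_mem (hπ_mem z)

section Average

variable {α E : Type*} [MeasurableSpace α] {μ : Measure α} [NormedAddCommGroup E] [NormedSpace ℝ E]
  [CompleteSpace E] {g : α → E} {s t : Set α}

theorem dist_setAverage_le {c : E} {R : ℝ} (hs : MeasurableSet s) (hs₀ : μ s ≠ 0) (hs' : μ s ≠ ⊤)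
    (hg : IntegrableOn g s μ) (hR : ∀ z ∈ s, dist (g z) c ≤ R) :
    dist (⨍ z in s, g z ∂μ) c ≤ R :=
  (convex_closedBall c R).set_average_mem isClosed_closedBall hs₀ hs'
    ((ae_restrict_iff' hs).2 (.of_forall hR)) hg

theorem dist_setAverage_setAverage_le {D : ℝ} (hst : s ⊆ t) (hs : MeasurableSet s)
    (ht : MeasurableSet t) (hs₀ : μ s ≠ 0) (ht' : μ t ≠ ⊤) (hg : IntegrableOn g t μ)
    (hD : ∀ z ∈ t, ∀ w ∈ t, dist (g z) (g w) ≤ D) :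
    dist (⨍ z in s, g z ∂μ) (⨍ z in t, g z ∂μ) ≤ D * (1 - μ.real s / μ.real t) := by
  have hs' : μ s ≠ ⊤ := measure_ne_top_of_subset hst ht'
  have hd' : μ (t \ s) ≠ ⊤ := measure_ne_top_of_subset Set.sdiff_subset ht'
  have hs_pos : 0 < μ.real s := ENNReal.toReal_pos hs₀ hs'
  have hadd : μ.real s + μ.real (t \ s) = μ.real t := by
    rw [measureReal_sdiff hst hs ht']; ring
  have ht_pos : 0 < μ.real t := hs_pos.trans_le (measureReal_mono hst ht')
  have hratio : μ.real (t \ s) / μ.real t = 1 - μ.real s / μ.real t := by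
    rw [← hadd] at ht_pos ⊢; field_simp; ring
  have hsub : ⨍ z in s, g z ∂μ - ⨍ z in t, g z ∂μ =
      (μ.real (t \ s) / μ.real t) • (⨍ z in s, g z ∂μ - ⨍ z in t \ s, g z ∂μ) := by
    have h := average_union (μ := μ) (f := g) Set.disjoint_sdiff_right.aedisjoint
      (ht.diff hs).nullMeasurableSet hs' hd' (hg.mono_set hst) (hg.mono_set Set.sdiff_subset)
    rw [Set.union_sdiff_cancel hst, hadd] at h
    rw [h, hratio]
    module
  rw [dist_eq_norm, hsub, norm_smul, Real.norm_of_nonneg (by positivity), hratio, mul_comm]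
  rcases eq_or_ne (μ (t \ s)) 0 with hd₀ | hd₀
  · have : 1 - μ.real s / μ.real t = 0 := by
      rw [← hratio, measureReal_def, hd₀, ENNReal.toReal_zero, zero_div]
    rw [this, mul_zero, mul_zero]
  · refine mul_le_mul_of_nonneg_right ?_ (hratio ▸ by positivity)
    rw [← dist_eq_norm]
    refine dist_setAverage_le hs hs₀ hs' (hg.mono_set hst) fun z hz => ?_
    rw [dist_comm]
    exact dist_setAverage_le (ht.diff hs) hd₀ hd' (hg.mono_set Set.sdiff_subset) fun w hw =>
      hD w hw.1 z (hst hz)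

end Average

variable {V E : Type*} [NormedAddCommGroup V] [NormedSpace ℝ V] [FiniteDimensional ℝ V]
  [NormedAddCommGroup E] [NormedSpace ℝ E] {L : ℝ≥0}

section Haar

variable [MeasurableSpace V] [BorelSpace V] {μ : Measure V} [μ.IsAddHaarMeasure]

theorem one_sub_measureReal_closedBall_div_le (x y : V) {r q : ℝ} (hr : 0 ≤ r) (hq : 0 < q) :
    1 - μ.real (closedBall x r) / μ.real (closedBall y q) ≤ finrank ℝ V * (1 - r / q) := by
  have hball : μ.real (ball 0 1) ≠ 0 :=
    (ENNReal.toReal_pos (measure_ball_pos μ 0 one_pos).ne' measure_ball_lt_top.ne).ne'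
  have hbernoulli := one_add_mul_le_pow (a := r / q - 1)
    (by linarith [div_nonneg hr hq.le]) (finrank ℝ V)
  rw [Measure.addHaar_real_closedBall μ x hr, Measure.addHaar_real_closedBall μ y hq.le,
    mul_div_mul_right _ _ hball, ← div_pow]
  rw [add_sub_cancel] at hbernoulli
  linarith

variable [CompleteSpace E] {S : Set V} {g : V → E}

open Classical in
variable (μ S g) in
/-- Whitney-type extension of `g|S`: off `S`, average `g` over the ball that just reaches `S`. -/
noncomputable def averagedExtension (y : V) : E :=
  if y ∈ S then g y else ⨍ z in closedBall y (infDist y S), g z ∂μ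

theorem dist_setAverage_closedBall_infDist_le (hS : IsClosed S) (hg_int : LocallyIntegrable g μ)
    (hg : ∀ z w, dist (g z) (g w) ≤ L * (infDist z S + dist z w + infDist w S))
    {x y : V} (hx : x ∈ S) (hy : y ∉ S) :
    dist (⨍ z in closedBall y (infDist y S), g z ∂μ) (g x) ≤ 4 * L * dist y x := by
  have hr : 0 < infDist y S := (hS.notMem_iff_infDist_pos ⟨x, hx⟩).1 hy
  refine dist_setAverage_le measurableSet_closedBall (measure_closedBall_pos μ y hr).ne'
    measure_closedBall_lt_top.ne (hg_int.integrableOn_isCompact (isCompact_closedBall _ _))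
    fun z hz => ?_
  have hzy : dist z y ≤ infDist y S := hz
  calc dist (g z) (g x) ≤ L * (infDist z S + dist z x + infDist x S) := hg z x
    _ ≤ L * (4 * dist y x) := by
      gcongr
      linarith [infDist_zero_of_mem hx, infDist_le_infDist_add_dist (s := S) (x := z) (y := y),
        infDist_le_dist_of_mem hx (x := y), dist_triangle z y x]
    _ = 4 * L * dist y x := by ring

/-- Both averages are compared with the average over a common ball slightly larger than either. -/
theorem dist_setAverage_closedBall_infDist_infDist_le (hS : IsClosed S) (hS' : S.Nonempty)
    (hg_int : LocallyIntegrable g μ)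
    (hg : ∀ z w, dist (g z) (g w) ≤ L * (infDist z S + dist z w + infDist w S))
    {x y : V} (hx : x ∉ S) (hy : y ∉ S) :
    dist (⨍ z in closedBall x (infDist x S), g z ∂μ) (⨍ z in closedBall y (infDist y S), g z ∂μ) ≤
      30 * finrank ℝ V * L * dist x y := by
  set q := infDist x S + 2 * dist x y
  have hrx : 0 < infDist x S := (hS.notMem_iff_infDist_pos hS').1 hx
  have hry : 0 < infDist y S := (hS.notMem_iff_infDist_pos hS').1 hy
  have hxy : 0 ≤ dist x y := dist_nonneg
  have hq0 : 0 < q := by positivity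
  have hryx : infDist y S ≤ infDist x S + dist x y :=
    dist_comm x y ▸ infDist_le_infDist_add_dist
  have hrxy : infDist x S ≤ infDist y S + dist x y := infDist_le_infDist_add_dist
  have hosc : ∀ z ∈ closedBall y q, ∀ w ∈ closedBall y q, dist (g z) (g w) ≤ 6 * L * q := by
    intro z hz w hw
    rw [mem_closedBall] at hz hw
    calc dist (g z) (g w) ≤ L * (infDist z S + dist z w + infDist w S) := hg z w
      _ ≤ L * (6 * q) := by
        gcongr
        linarith [infDist_le_infDist_add_dist (s := S) (x := z) (y := y),
          infDist_le_infDist_add_dist (s := S) (x := w) (y := y), dist_triangle_right z w y]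
      _ = 6 * L * q := by ring
  have hnested : ∀ u r, 0 < r → closedBall u r ⊆ closedBall y q →
      dist (⨍ z in closedBall u r, g z ∂μ) (⨍ z in closedBall y q, g z ∂μ) ≤
        6 * finrank ℝ V * L * (q - r) := by
    intro u r hr hsub
    calc _ ≤ 6 * L * q * (1 - μ.real (closedBall u r) / μ.real (closedBall y q)) :=
          dist_setAverage_setAverage_le hsub measurableSet_closedBall measurableSet_closedBall
            (measure_closedBall_pos μ u hr).ne' measure_closedBall_lt_top.ne
            (hg_int.integrableOn_isCompact (isCompact_closedBall _ _)) hosc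
      _ ≤ 6 * L * q * (finrank ℝ V * (1 - r / q)) := by
          gcongr; exact one_sub_measureReal_closedBall_div_le u y hr.le hq0
      _ = 6 * finrank ℝ V * L * (q - r) := by field_simp
  calc _ ≤ 6 * finrank ℝ V * L * (q - infDist x S) + 6 * finrank ℝ V * L * (q - infDist y S) :=
        (dist_triangle_right _ _ _).trans <| add_le_add
          (hnested x _ hrx (closedBall_subset_closedBall' (by linarith)))
          (hnested y _ hry (closedBall_subset_closedBall (by linarith)))
    _ = 6 * finrank ℝ V * L * (2 * q - infDist x S - infDist y S) := by ring
    _ ≤ 6 * finrank ℝ V * L * (5 * dist x y) := by gcongr; linarith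
    _ = 30 * finrank ℝ V * L * dist x y := by ring

theorem lipschitzWith_averagedExtension [Nontrivial V] (hS : IsClosed S) (hS' : S.Nonempty)
    (hg_int : LocallyIntegrable g μ)
    (hg : ∀ z w, dist (g z) (g w) ≤ L * (infDist z S + dist z w + infDist w S)) :
    LipschitzWith (30 * finrank ℝ V * L) (averagedExtension μ S g) := by
  have hdim : (1 : ℝ) ≤ finrank ℝ V := mod_cast finrank_pos (R := ℝ) (M := V)
  have hmono : ∀ {c : ℝ} (x y : V), c ≤ 30 → c * L * dist x y ≤ 30 * finrank ℝ V * L * dist x y :=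
    fun x y hc => by gcongr; linarith
  refine .of_dist_le_mul fun x y => ?_
  push_cast
  by_cases hx : x ∈ S <;> by_cases hy : y ∈ S <;>
    simp only [averagedExtension, hx, hy, if_true, if_false]
  · refine (hg x y).trans (le_trans (le_of_eq ?_) (hmono (c := 1) x y (by norm_num)))
    rw [infDist_zero_of_mem hx, infDist_zero_of_mem hy]
    ring
  · rw [dist_comm, dist_comm x]
    exact (dist_setAverage_closedBall_infDist_le hS hg_int hg hx hy).trans
      (hmono y x (by norm_num))
  · exact (dist_setAverage_closedBall_infDist_le hS hg_int hg hy hx).trans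
      (hmono x y (by norm_num))
  · exact dist_setAverage_closedBall_infDist_infDist_le hS hS' hg_int hg hx hy

end Haar

theorem exists_lipschitzWith_eqOn_of_completeSpace [CompleteSpace E] {S : Finset V} {f : V → E}
    (hf : LipschitzOnWith L f S) :
    ∃ M : V → E, LipschitzWith (30 * finrank ℝ V * L) M ∧ Set.EqOn M f S := by
  rcases subsingleton_or_nontrivial V with hV | hV
  · exact ⟨f, .of_dist_le_mul fun x y => by simp [Subsingleton.elim x y], Set.eqOn_refl f S⟩
  rcases S.eq_empty_or_nonempty with rfl | hS
  · exact ⟨0, LipschitzWith.const' 0, by simp⟩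
  let : MeasurableSpace V := borel V
  have : BorelSpace V := ⟨rfl⟩
  obtain ⟨π, hπ⟩ := exists_simpleFunc_dist_eq_infDist hS
  have hπ_self : ∀ z ∈ S, π z = z := fun z hz => by
    rw [eq_comm, ← dist_eq_zero, (hπ z).2, infDist_zero_of_mem (Finset.mem_coe.2 hz)]
  refine ⟨averagedExtension Measure.addHaar S (f ∘ π),
    lipschitzWith_averagedExtension S.finite_toSet.isClosed hS ?_ fun z w => ?_, fun z hz => ?_⟩
  · refine fun x => ⟨closedBall x 1, closedBall_mem_nhds x one_pos, ?_⟩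
    have : IsFiniteMeasure (Measure.addHaar.restrict (closedBall x 1)) :=
      isFiniteMeasure_restrict.2 measure_closedBall_lt_top.ne
    exact (π.map f).integrable_of_isFiniteMeasure
  · refine (hf.dist_le_mul _ (hπ z).1 _ (hπ w).1).trans ?_
    gcongr
    rw [← (hπ z).2, ← (hπ w).2, dist_comm z (π z)]
    exact dist_triangle4 _ _ _ _
  · simp [averagedExtension, Finset.mem_coe.1 hz, hπ_self z hz]

theorem exists_lipschitzWith_eqOn {S : Finset V} {f : V → E} (hf : LipschitzOnWith L f S) :
    ∃ M : V → E, LipschitzWith (30 * finrank ℝ V * L) M ∧ Set.EqOn M f S := by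
  classical
  let F := Submodule.span ℝ (f '' S)
  have : FiniteDimensional ℝ F :=
    FiniteDimensional.span_of_finite ℝ (S.finite_toSet.image f)
  have : CompleteSpace F := FiniteDimensional.complete ℝ F
  have hfF : ∀ v ∈ S, f v ∈ F := fun v hv => Submodule.subset_span ⟨v, hv, rfl⟩
  let f' : V → F := fun v => if hv : v ∈ S then ⟨f v, hfF v hv⟩ else 0
  have hf' : ∀ v ∈ S, (f' v : E) = f v := fun v hv => by simp [f', hv]
  obtain ⟨M, hM, hM_eq⟩ := exists_lipschitzWith_eqOn_of_completeSpace (S := S) (f := f') <|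
    .of_dist_le_mul fun v hv w hw => by
      rw [Subtype.dist_eq, hf' v hv, hf' w hw]
      exact hf.dist_le_mul v hv w hw
  exact ⟨fun v => M v, .of_dist_le_mul hM.dist_le_mul, fun v hv => by
    rw [← hf' v hv, ← hM_eq hv]⟩

theorem exists_lipschitzWith_leftInvOn {A : Finset E} {a : E → V}
    (ha : ∀ x ∈ A, ∀ y ∈ A, dist x y ≤ L * dist (a x) (a y)) :
    ∃ M : V → E, LipschitzWith (30 * finrank ℝ V * L) M ∧ Set.LeftInvOn M a A := by
  classical
  have ha_inj : Set.InjOn a A := fun x hx y hy h => by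
    simpa [h] using ha x hx y hy
  have hleft : ∀ x ∈ A, Function.invFunOn a A (a x) = x := fun x hx =>
    ha_inj.leftInvOn_invFunOn hx
  obtain ⟨M, hM, hM_eq⟩ := exists_lipschitzWith_eqOn (S := A.image a)
    (f := Function.invFunOn a A) <| .of_dist_le_mul fun v hv w hw => by
      obtain ⟨x, hx, rfl⟩ := Finset.mem_image.1 hv
      obtain ⟨y, hy, rfl⟩ := Finset.mem_image.1 hw
      rw [hleft x hx, hleft y hy]
      exact ha x hx y hy
  exact ⟨M, hM, fun x hx => (hM_eq (Finset.mem_image_of_mem a hx)).trans (hleft x hx)⟩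

end LipschitzExtension

section EntropyNumber

open Bornology Metric

variable {X : Type u} {n : ℕ}

theorem entropyNumber_nonneg [PseudoMetricSpace X] (n : ℕ) (K : Set X) : 0 ≤ entropyNumber n K :=
  Real.sInf_nonneg fun _ h => h.1.le

theorem exists_finset_of_entropyNumber_lt [PseudoMetricSpace X] {K : Set X} (hK : IsBounded K)
    {ε : ℝ} (hε : entropyNumber n K < ε) :
    ∃ A : Finset X, #A ≤ 2 ^ n ∧ ∀ f ∈ K, ∃ x ∈ A, dist f x ≤ ε := by
  classical
  rcases K.eq_empty_or_nonempty with rfl | ⟨x₀, -⟩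
  · exact ⟨∅, by simp⟩
  have hne : {ε : ℝ | 0 < ε ∧ ∃ c : Fin (2 ^ n) → X, K ⊆ ⋃ i, closedBall (c i) ε}.Nonempty := by
    obtain ⟨R, hR, hKR⟩ := hK.subset_closedBall_lt 0 x₀
    exact ⟨R, hR, fun _ => x₀, by rwa [Set.iUnion_const]⟩
  obtain ⟨r, ⟨-, c, hc⟩, hr⟩ := exists_lt_of_csInf_lt hne hε
  refine ⟨Finset.univ.image c, Finset.card_image_le.trans (by simp), fun f hf => ?_⟩
  obtain ⟨i, hi⟩ := Set.mem_iUnion.1 (hc hf)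
  exact ⟨c i, Finset.mem_image_of_mem c (Finset.mem_univ i), (mem_closedBall.1 hi).trans hr.le⟩

variable [MetricSpace X] {K : Set X}

theorem card_le_of_entropyNumber_eq_zero (hK : IsBounded K) (h : entropyNumber n K = 0)
    {T : Finset X} (hT : (T : Set X) ⊆ K) : #T ≤ 2 ^ n := by
  rcases (T : Set X).subsingleton_or_nontrivial with hT' | hT'
  · exact (Finset.card_le_one_iff_subsingleton.2 hT').trans Nat.one_le_two_pow
  have hsep : 0 < (T : Set X).infsep := T.finite_toSet.infsep_pos_iff_nontrivial.2 hT'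
  obtain ⟨A, hA, hKA⟩ := exists_finset_of_entropyNumber_lt (n := n) hK
    (ε := (T : Set X).infsep / 3) (by rw [h]; positivity)
  choose! c hcA hc using hKA
  refine (Finset.card_le_card_of_injOn c (fun x hx => hcA x (hT hx)) fun x hx y hy hxy => ?_).trans
    hA
  by_contra hne
  have hle : (T : Set X).infsep ≤ dist x y := Set.infsep_le_dist_of_mem hx hy hne
  linarith [hc x (hT hx), hxy ▸ hc y (hT hy), dist_triangle_right x y (c x)]

theorem encard_le_of_entropyNumber_eq_zero (hK : IsBounded K) (h : entropyNumber n K = 0) :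
    K.encard ≤ 2 ^ n := by
  by_contra! hcard
  obtain ⟨T, hTK, hT⟩ := Set.exists_subset_encard_eq (Order.add_one_le_of_lt hcard)
  have hT_fin : T.Finite := Set.finite_of_encard_eq_coe (k := 2 ^ n + 1) (mod_cast hT)
  lift T to Finset X using hT_fin
  rw [Set.encard_coe_eq_coe_finsetCard] at hT
  have hT' : #T = 2 ^ n + 1 := mod_cast hT
  exact (card_le_of_entropyNumber_eq_zero hK h hTK).not_gt (hT' ▸ Nat.lt_succ_self _)

theorem exists_finset_dist_le_two_mul_entropyNumber (hK : IsBounded K) (n : ℕ) :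
    ∃ A : Finset X, #A ≤ 2 ^ n ∧ ∀ f ∈ K, ∃ x ∈ A, dist f x ≤ 2 * entropyNumber n K := by
  rcases (entropyNumber_nonneg n K).eq_or_lt with h₀ | h₀
  · have hcard := encard_le_of_entropyNumber_eq_zero hK h₀.symm
    have hK_fin : K.Finite := Set.finite_of_encard_le_coe (k := 2 ^ n) (mod_cast hcard)
    rw [hK_fin.encard_eq_coe_toFinset_card] at hcard
    refine ⟨hK_fin.toFinset, mod_cast hcard, fun f hf => ⟨f, hK_fin.mem_toFinset.2 hf, ?_⟩⟩
    rw [dist_self, ← h₀, mul_zero]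
  · exact exists_finset_of_entropyNumber_lt hK (by linarith)

end EntropyNumber

section Factorization

theorem dist_apply_le_of_apply_eq {X Y : Type*} [PseudoMetricSpace X] [PseudoMetricSpace Y]
    {a : X → Y} {M : Y → X} {La LM : ℝ≥0} (ha : LipschitzWith La a) (hM : LipschitzWith LM M)
    {x : X} (hx : M (a x) = x) (f : X) : dist f (M (a f)) ≤ (1 + LM * La) * dist f x :=
  calc dist f (M (a f)) ≤ dist f x + dist (M (a f)) (M (a x)) := by
        rw [hx]
        exact dist_triangle_right _ _ _
    _ ≤ dist f x + (LM * La : ℝ≥0) * dist f x := by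
        gcongr
        exact (hM.comp ha).dist_le_mul f x
    _ = (1 + LM * La) * dist f x := by
        push_cast
        ring

theorem exists_lipschitzWith_lipschitzWith_leftInvOn {X : Type*} [NormedAddCommGroup X]
    [NormedSpace ℝ X] {A : Finset X} {n : ℕ} (hn : n ≠ 0) (hA : #A ≤ 2 ^ n) :
    ∃ (a : X → Fin (26 * n) → ℝ) (M : (Fin (26 * n) → ℝ) → X),
      LipschitzWith (2 * (n : ℝ≥0) ^ (5 / 4 : ℝ)) a ∧
      LipschitzWith (156000 * (n : ℝ≥0) ^ (5 / 4 : ℝ)) M ∧ Set.LeftInvOn M a A := by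
  have hn₀ : (n : ℝ≥0) ≠ 0 := Nat.cast_ne_zero.2 hn
  obtain ⟨F, hF, hFA⟩ := exists_lipschitzWith_two_mul hn hA
  set c : ℝ≥0 := (n : ℝ≥0) ^ (1 / 4 : ℝ) with hc
  have hc₀ : c ≠ 0 := (NNReal.rpow_pos (pos_iff_ne_zero.2 hn₀)).ne'
  have hcn : c * n = (n : ℝ≥0) ^ (5 / 4 : ℝ) := by
    rw [hc, ← NNReal.rpow_add_one hn₀]
    norm_num
  have hcn' : n * (NNReal.sqrt n / c) = (n : ℝ≥0) ^ (5 / 4 : ℝ) := by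
    rw [hc, NNReal.sqrt_eq_rpow, ← NNReal.rpow_sub hn₀, mul_comm, ← NNReal.rpow_add_one hn₀]
    norm_num
  obtain ⟨M, hM, hMA⟩ := exists_lipschitzWith_leftInvOn (A := A) (a := fun x => (c : ℝ) • F x)
    (L := 200 * (NNReal.sqrt n / c)) fun x hx y hy => by
      refine (hFA x hx y hy).trans_eq ?_
      rw [dist_smul₀, Real.norm_of_nonneg c.coe_nonneg]
      push_cast
      field_simp
  refine ⟨fun x => (c : ℝ) • F x, M, ?_, ?_, hMA⟩
  · refine ((lipschitzWith_smul (c : ℝ)).comp hF).weaken (le_of_eq ?_)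
    rw [← hcn, NNReal.nnnorm_eq]
    ring
  · refine hM.weaken (le_of_eq ?_)
    rw [← hcn', Module.finrank_fin_fun]
    push_cast
    ring

end Factorization

theorem theorem5p1_general :
    ∃ C : ℝ≥0, 0 < C ∧
      ∀ (X : Type u) [NormedAddCommGroup X] [NormedSpace ℝ X]
        (K : Set X), Bornology.IsBounded K →
        ∀ n : ℕ, 1 ≤ n →
          ∃ (a : X → (Fin (26 * n) → ℝ)) (M : (Fin (26 * n) → ℝ) → X),
            LipschitzWith (C * (n : ℝ≥0) ^ (5 / 4 : ℝ)) a ∧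
            LipschitzWith (C * (n : ℝ≥0) ^ (5 / 4 : ℝ)) M ∧
            ∀ f ∈ K, ‖f - M (a f)‖ ≤ (C : ℝ) * (n : ℝ) ^ (5 / 2 : ℝ) * entropyNumber n K := by
  refine ⟨1000000, by norm_num, fun X _ _ K hK n hn => ?_⟩
  obtain ⟨A, hA, hKA⟩ := exists_finset_dist_le_two_mul_entropyNumber hK n
  obtain ⟨a, M, ha, hM, hMA⟩ :=
    exists_lipschitzWith_lipschitzWith_leftInvOn (Nat.one_le_iff_ne_zero.1 hn) hA
  refine ⟨a, M, ha.weaken (by gcongr; norm_num), hM.weaken (by gcongr; norm_num), fun f hf => ?_⟩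
  obtain ⟨x, hx, hfx⟩ := hKA f hf
  have hpow : (n : ℝ) ^ (5 / 2 : ℝ) = (n : ℝ) ^ (5 / 4 : ℝ) * (n : ℝ) ^ (5 / 4 : ℝ) := by
    rw [← Real.rpow_add (by positivity)]
    norm_num
  have hone : 1 ≤ (n : ℝ) ^ (5 / 2 : ℝ) := Real.one_le_rpow (mod_cast hn) (by norm_num)
  calc ‖f - M (a f)‖ = dist f (M (a f)) := (dist_eq_norm _ _).symm
    _ ≤ (1 + 312000 * (n : ℝ) ^ (5 / 2 : ℝ)) * dist f x := by
      refine (dist_apply_le_of_apply_eq ha hM (hMA hx) f).trans_eq ?_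
      rw [hpow]
      push_cast
      ring
    _ ≤ 500000 * (n : ℝ) ^ (5 / 2 : ℝ) * (2 * entropyNumber n K) := by
      gcongr
      linarith
    _ = (1000000 : ℝ≥0) * (n : ℝ) ^ (5 / 2 : ℝ) * entropyNumber n K := by
      push_cast
      ring

/-- `Fin (26 * n) → ℝ` carries the sup norm, i.e. it is `ℓ_∞^{26n}`. -/
theorem theorem5p1 :
    ∃ C : ℝ≥0, 0 < C ∧
      ∀ (X : Type u) [NormedAddCommGroup X] [NormedSpace ℝ X] [CompleteSpace X]
        (K : Set X), IsCompact K →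
        ∀ n : ℕ, 1 ≤ n →
          ∃ (a : X → (Fin (26 * n) → ℝ)) (M : (Fin (26 * n) → ℝ) → X),
            LipschitzWith (C * (n : ℝ≥0) ^ (5 / 4 : ℝ)) a ∧
            LipschitzWith (C * (n : ℝ≥0) ^ (5 / 4 : ℝ)) M ∧
            ∀ f ∈ K, ‖f - M (a f)‖ ≤ (C : ℝ) * (n : ℝ) ^ (5 / 2 : ℝ) * entropyNumber n K := by
  obtain ⟨C, hC, h⟩ := theorem5p1_general.{u}
  exact ⟨C, hC, fun X _ _ _ K hK => h X K hK.isBounded⟩
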